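/- Let $\mathbb{P}$ be the random poset, that is, the Fraïssé limit of the class of all finite partially ordered sets (the countable ultrahomogeneous poset, unique up to isomorphism, whose finite substructures are, up to isomorphism, exactly the finite posets). Give $G=\mathrm{Aut}(\mathbb{P})$ the topology of pointwise convergence on the discrete set $\mathbb{P}$; it is a Polish group. For a standard non-atomic probability space $(X,\mu)$ (for instance $[0,1]$ with Lebesgue measure) let $L_0(G)=L_0(X,\mu;G)$ be the group of $\mu$-equivalence classes of measurable functions $X\to G$, with pointwise multiplication and the topology of convergence in measure: a neighbourhood basis at $h$ is given by the sets $\{g : \mu(\{x : d(g(x),h(x))<\delta\})>1-\varepsilon\}$, $\delta,\varepsilon>0$, where $d$ is a fixed compatible complete metric on $G$. A pair $(g,h)$ of elements of a topological group $H$ cyclically generates $H$ if $\{g^l h g^{-l} : l\in\mathbb{Z}\}$ is dense in $H$; if such a pair exists, $H$ is said to have a cyclically dense conjugacy class. Theorem. For every integer $n\ge 1$ the group $\mathrm{Aut}(\mathbb{P})^n$ (with the product topology) has a cyclically dense conjugacy class, and so does $L_0(\mathrm{Aut}(\mathbb{P}))$. In fact, each of these groups is cyclically generated by a pair $(g,h)$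 which freely generates a free group (of rank two). -/

import Mathlib

open MeasureTheory Topology

universe u

/-! ### Cyclic generation -/

/-- `(g, h)` topologically cyclically generates `G`: the set `{g ^ l * h * g ^ (-l) | l ∈ ℤ}` is
dense in `G`. -/
def CyclicallyGenerates {G : Type*} [Group G] [TopologicalSpace G] (g h : G) : Prop :=
  Dense {k : G | ∃ l : ℤ, k = g ^ l * h * g ^ (-l)}

/-- `G` has a cyclically dense conjugacy class. -/
def HasCyclicallyDenseConjClass (G : Type*) [Group G] [TopologicalSpace G] : Prop :=
  ∃ g h : G, CyclicallyGenerates g h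

/-- `g` and `h` freely generate a free group of rank two: no nontrivial reduced word in `g` and `h`
is the identity. -/
def GenerateFreeGroup {G : Type*} [Group G] (g h : G) : Prop :=
  Function.Injective (FreeGroup.lift ![g, h] : FreeGroup (Fin 2) →* G)

/-! ### The random poset -/

/-- The class of all finite partially ordered sets, as structures in the language with one binary
relation symbol `≤`. -/
def finitePosets : Set (CategoryTheory.Bundled.{u} FirstOrder.Language.order.Structure) :=
  {M | Finite M ∧ M ⊨ FirstOrder.Language.order.partialOrderTheory}

/-- `P` is (a copy of) the random poset: the Fraïssé limit of the class of all finite partially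
ordered sets, that is, a countable ultrahomogeneous poset whose age is this class. -/
def IsRandomPoset (P : Type u) [PartialOrder P] [Countable P] : Prop :=
  letI : FirstOrder.Language.order.Structure P := FirstOrder.Language.orderStructure P
  FirstOrder.Language.IsFraisseLimit finitePosets.{u} P

/-! ### The automorphism group with the topology of pointwise convergence -/

section Aut

variable {P : Type*} [PartialOrder P]

/-- The topology of pointwise convergence on `Aut(P)`, with `P` discrete. -/
instance orderAutTopology : TopologicalSpace (P ≃o P) :=
  TopologicalSpace.induced (fun (g : P ≃o P) (x : P) => g x)
    (@Pi.topologicalSpace P (fun _ => P) (fun _ => ⊥))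

theorem isOpen_orderAut_eval (x y : P) : IsOpen {g : P ≃o P | g x = y} := by
  let _ : TopologicalSpace P := ⊥
  have : DiscreteTopology P := ⟨rfl⟩
  have h : Continuous (fun g : P ≃o P => g x) :=
    (continuous_apply x).comp (continuous_induced_dom (f := fun (g : P ≃o P) (x : P) => g x))
  exact (isOpen_discrete {y}).preimage h

theorem continuous_orderAut_of_eval {Z : Type*} [TopologicalSpace Z] {f : Z → (P ≃o P)}
    (h : ∀ x y : P, IsOpen {z | f z x = y}) : Continuous f := by
  let _ : TopologicalSpace P := ⊥
  have : DiscreteTopology P := ⟨rfl⟩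
  refine continuous_induced_rng.2 (continuous_pi fun x => ?_)
  exact continuous_discrete_rng.2 fun y => h x y

instance orderAut_isTopologicalGroup : IsTopologicalGroup (P ≃o P) where
  continuous_mul := continuous_orderAut_of_eval fun x y => by
    have : {z : (P ≃o P) × (P ≃o P) | (z.1 * z.2) x = y}
        = ⋃ w : P, {z | z.2 x = w} ∩ {z | z.1 w = y} := by
      ext z; simp [RelIso.mul_apply]
    rw [this]
    exact isOpen_iUnion fun w => ((isOpen_orderAut_eval x w).preimage continuous_snd).inter
      ((isOpen_orderAut_eval w y).preimage continuous_fst)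
  continuous_inv := continuous_orderAut_of_eval fun x y => by
    have : {g : P ≃o P | g⁻¹ x = y} = {g | g y = x} := by
      ext g
      exact (OrderIso.symm_apply_eq g).trans eq_comm
    rw [this]
    exact isOpen_orderAut_eval y x

instance orderAut_polishSpace [Countable P] : PolishSpace (P ≃o P) := by
  let _ : TopologicalSpace P := ⊥
  have : DiscreteTopology P := ⟨rfl⟩
  have : PolishSpace P := inferInstance
  have : PolishSpace (P → P) := {}
  have : PolishSpace ((P → P) × (P → P)) := {}
  let F : (P ≃o P) → (P → P) × (P → P) := fun g => (fun x => g x, fun x => g⁻¹ x)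
  have hcoe : Continuous (fun (g : P ≃o P) (x : P) => g x) := continuous_induced_dom
  have hF : Continuous F := hcoe.prodMk (hcoe.comp continuous_inv)
  have hind : IsInducing F :=
    IsInducing.of_comp hF continuous_fst ⟨rfl⟩
  have hinj : Function.Injective F := fun g h e =>
    DFunLike.ext _ _ fun x => congrFun (congrArg Prod.fst e) x
  have hev1 : ∀ x, Continuous fun p : (P → P) × (P → P) => p.1 x := fun x =>
    (continuous_apply x).comp continuous_fst
  have hev2 : ∀ x, Continuous fun p : (P → P) × (P → P) => p.2 x := fun x =>
    (continuous_apply x).comp continuous_snd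
  have hcomp1 : ∀ x y, IsClosed {p : (P → P) × (P → P) | p.1 x = y → p.2 y = x} := fun x y =>
    ((isClopen_discrete {q : P × P | q.1 = y → q.2 = x}).preimage
      ((hev1 x).prodMk (hev2 y))).isClosed
  have hcomp2 : ∀ x y, IsClosed {p : (P → P) × (P → P) | p.2 x = y → p.1 y = x} := fun x y =>
    ((isClopen_discrete {q : P × P | q.1 = y → q.2 = x}).preimage
      ((hev2 x).prodMk (hev1 y))).isClosed
  have hle : ∀ x y, IsClosed {p : (P → P) × (P → P) | p.1 x ≤ p.1 y ↔ x ≤ y} := fun x y =>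
    ((isClopen_discrete {q : P × P | q.1 ≤ q.2 ↔ x ≤ y}).preimage
      ((hev1 x).prodMk (hev1 y))).isClosed
  have hrange : Set.range F = (⋂ x, ⋂ y, {p | p.1 x = y → p.2 y = x}) ∩
      ((⋂ x, ⋂ y, {p | p.2 x = y → p.1 y = x}) ∩
        (⋂ x, ⋂ y, {p | p.1 x ≤ p.1 y ↔ x ≤ y})) := by
    ext p
    simp only [Set.mem_range, Set.mem_inter_iff, Set.mem_iInter, Set.mem_ofPred_eq]
    constructor
    · rintro ⟨g, rfl⟩
      refine ⟨?_, ?_, fun x y => g.le_iff_le⟩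
      · rintro x y rfl
        exact g.symm_apply_apply x
      · rintro x y rfl
        exact g.apply_symm_apply x
    · rintro ⟨h1, h2, h3⟩
      exact ⟨⟨⟨p.1, p.2, fun x => h1 x _ rfl, fun x => h2 x _ rfl⟩, fun {x y} => h3 x y⟩, rfl⟩
  have hclosed : IsClosed (Set.range F) := by
    rw [hrange]
    exact (isClosed_iInter fun x => isClosed_iInter fun y => hcomp1 x y).inter
      ((isClosed_iInter fun x => isClosed_iInter fun y => hcomp2 x y).inter
        (isClosed_iInter fun x => isClosed_iInter fun y => hle x y))
  exact (IsClosedEmbedding.mk ⟨hind, hinj⟩ hclosed).polishSpace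

end Aut

/-! ### The space of measurable functions with the topology of convergence in measure -/

section L0

variable {X : Type*} [MeasurableSpace X]

/-- `L₀(X, μ; Y)`: the `μ`-equivalence classes of measurable functions from `X` to the Polish space
`Y`. (For Polish `Y` with its Borel sets, `μ`-a.e. strongly measurable functions are exactly
the functions that agree `μ`-a.e. with a Borel measurable one.) -/
def LZero (μ : Measure X) (Y : Type*) [TopologicalSpace Y] : Type _ :=
  X →ₘ[μ] Y

/-- The pointwise multiplication of classes of functions. -/
noncomputable instance LZero.instGroup (μ : Measure X) (G : Type*) [TopologicalSpace G] [Group G]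
    [IsTopologicalGroup G] : Group (LZero μ G) :=
  inferInstanceAs (Group (X →ₘ[μ] G))

/-- A function representing the class `f`. -/
noncomputable def LZero.rep {μ : Measure X} {Y : Type*} [TopologicalSpace Y] (f : LZero μ Y) :
    X → Y :=
  AEEqFun.cast (μ := μ) f

/-- The basic neighbourhood
`[h, δ, ε] = {g | μ {x | d (g x) (h x) < δ} > 1 - ε}`, for a metric `d` on `Y`. -/
def LZero.basicNhd {μ : Measure X} {Y : Type*} [TopologicalSpace Y] (d : MetricSpace Y)
    (h : LZero μ Y) (δ ε : ℝ) : Set (LZero μ Y) :=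
  {g | 1 - ε < μ.real {x | d.dist (g.rep x) (h.rep x) < δ}}

/-- A fixed complete metric on `Y` compatible with its topology. -/
@[reducible] noncomputable def compatibleCompleteMetric (Y : Type*) [TopologicalSpace Y] [PolishSpace Y] :
    MetricSpace Y :=
  TopologicalSpace.completelyMetrizableMetric Y

/-- The topology of convergence in measure on `L₀(X, μ; Y)` (`μ` a probability measure, `Y` Polish):
the sets `[h, δ, ε]` with `δ, ε > 0` form a neighbourhood basis at `h`. -/
instance LZero.instTopologicalSpace (μ : Measure X) [IsProbabilityMeasure μ] (Y : Type*)
    [TopologicalSpace Y] [PolishSpace Y] : TopologicalSpace (LZero μ Y) where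
  IsOpen U := ∀ h ∈ U, ∃ δ > 0, ∃ ε > 0, LZero.basicNhd (compatibleCompleteMetric Y) h δ ε ⊆ U
  isOpen_univ := fun _ _ => ⟨1, one_pos, 1, one_pos, Set.subset_univ _⟩
  isOpen_inter := by
    rintro U V hU hV h ⟨hhU, hhV⟩
    obtain ⟨δ₁, hδ₁, ε₁, hε₁, h₁⟩ := hU h hhU
    obtain ⟨δ₂, hδ₂, ε₂, hε₂, h₂⟩ := hV h hhV
    refine ⟨min δ₁ δ₂, lt_min hδ₁ hδ₂, min ε₁ ε₂, lt_min hε₁ hε₂, fun g hg => ⟨h₁ ?_, h₂ ?_⟩⟩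
    · have hle : 1 - ε₁ ≤ 1 - min ε₁ ε₂ := sub_le_sub_left (min_le_left _ _) _
      exact (hle.trans_lt hg).trans_le
        (measureReal_mono (Set.ofPred_subset_ofPred.2 fun x hx => lt_of_lt_of_le hx (min_le_left _ _)))
    · have hle : 1 - ε₂ ≤ 1 - min ε₁ ε₂ := sub_le_sub_left (min_le_right _ _) _
      exact (hle.trans_lt hg).trans_le
        (measureReal_mono (Set.ofPred_subset_ofPred.2 fun x hx => lt_of_lt_of_le hx (min_le_right _ _)))
  isOpen_sUnion := by
    rintro S hS h ⟨U, hUS, hhU⟩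
    obtain ⟨δ, hδ, ε, hε, hsub⟩ := hS U hUS h hhU
    exact ⟨δ, hδ, ε, hε, hsub.trans (Set.subset_sUnion_of_mem hUS)⟩

end L0

/-! ### Finite partial isomorphisms and back-and-forth -/

section PartialIso

/-! The proof rests on an automorphism `g` of the poset that pushes every point above every other:
for all `x`, `y`, eventually `x < g ^ k y`. Given a finite partial isomorphism and a finite block, a
power of `g` moves the block above all points used so far, so any partial isomorphism between points
of the moved block may be adjoined. A back-and-forth construction thus writes a whole sequence of
automorphisms `d` into one automorphism `H d`, and conjugating `H d` by suitable powers of `g`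
converges to each `d m`. The exponents do not depend on `d`, and `H` is continuous
(`exists_continuous_encoding`, `exists_tendsto_conj`).

Uniformity of the exponents lets one constant `g` serve all coordinates, or all points of `X`, at
once, with `d` running through a dense sequence; continuity of `H` keeps the second generator
measurable, and pointwise limits become limits in measure.

For freeness, `g` is found together with some `u` such that `g`, `u` are free, and `u` is added to
the sequence. A relation between `g` and `h` survives conjugation by powers of `g` and limits, hence
would hold between `g` and `u`.

The pair `g`, `u` comes from an invariant order on countably many copies of the free group, generic
enough to be isomorphic to the random poset (`exists_poset_action`, `nonempty_orderIso`). -/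

/-- Every consistent requirement to lie between two finite sets is realized by a point having no
further relations to a prescribed finite set. -/
def HasOnePointExtensions (α : Type*) [PartialOrder α] : Prop :=
  ∀ L U A : Finset α, (∀ l ∈ L, ∀ u ∈ U, l < u) →
    ∃ x, x ∉ A ∧ (∀ l ∈ L, l < x) ∧ (∀ u ∈ U, x < u) ∧
      (∀ a ∈ A, a < x → ∃ l ∈ L, a ≤ l) ∧ (∀ a ∈ A, x < a → ∃ u ∈ U, u ≤ a)

variable {α β : Type*} [PartialOrder α] [PartialOrder β]

/-- A set of pairs that is (the graph of) an isomorphism between two suborders. -/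
def IsPartialIso (S : Set (α × β)) : Prop :=
  ∀ p ∈ S, ∀ q ∈ S, p.1 ≤ q.1 ↔ p.2 ≤ q.2

theorem IsPartialIso.swap {S : Set (α × β)} (hS : IsPartialIso S) :
    IsPartialIso (Prod.swap '' S) := by
  rintro _ ⟨p, hp, rfl⟩ _ ⟨q, hq, rfl⟩
  exact (hS p hp q hq).symm

theorem IsPartialIso.lt_iff {S : Set (α × β)} (hS : IsPartialIso S) {p q : α × β}
    (hp : p ∈ S) (hq : q ∈ S) : p.1 < q.1 ↔ p.2 < q.2 := by
  rw [lt_iff_le_not_ge, lt_iff_le_not_ge, hS p hp q hq, hS q hq p hp]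

/-- The image of `a` is taken between the images of the points below and above `a`, with no other
relation to the range of `S`. -/
theorem IsPartialIso.exists_insert (hβ : HasOnePointExtensions β) {S : Finset (α × β)}
    (hS : IsPartialIso (S : Set (α × β))) (a : α) :
    ∃ b, IsPartialIso (insert (a, b) (S : Set (α × β))) := by
  classical
  by_cases ha : ∃ p ∈ S, p.1 = a
  · obtain ⟨⟨_, b⟩, hp, rfl⟩ := ha
    exact ⟨b, by rwa [Set.insert_eq_of_mem (by exact_mod_cast hp)]⟩
  push Not at ha
  obtain ⟨b, hbA, hL, hU, hLA, hUA⟩ := hβ ((S.filter (·.1 < a)).image Prod.snd)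
    ((S.filter (a < ·.1)).image Prod.snd) (S.image Prod.snd) (by
      simp only [Finset.mem_image, Finset.mem_filter]
      rintro _ ⟨p, ⟨hp, hpa⟩, rfl⟩ _ ⟨q, ⟨hq, hqa⟩, rfl⟩
      exact (hS.lt_iff hp hq).1 (hpa.trans hqa))
  simp only [Finset.mem_image, Finset.mem_filter] at hbA hL hU hLA hUA
  have hbne : ∀ p ∈ S, p.2 ≠ b := fun p hp h => hbA ⟨p, hp, h⟩
  have h1 : ∀ p ∈ S, p.1 ≤ a ↔ p.2 ≤ b := fun p hp => by
    constructor
    · exact fun h => (hL _ ⟨p, ⟨hp, lt_of_le_of_ne h (ha p hp)⟩, rfl⟩).le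
    · intro h
      obtain ⟨_, ⟨q, ⟨hq, hqa⟩, rfl⟩, hpq⟩ :=
        hLA p.2 ⟨p, hp, rfl⟩ (lt_of_le_of_ne h (hbne p hp))
      exact ((hS p hp q hq).2 hpq).trans hqa.le
  have h2 : ∀ p ∈ S, a ≤ p.1 ↔ b ≤ p.2 := fun p hp => by
    constructor
    · exact fun h => (hU _ ⟨p, ⟨hp, lt_of_le_of_ne h (ha p hp).symm⟩, rfl⟩).le
    · intro h
      obtain ⟨_, ⟨q, ⟨hq, hqa⟩, rfl⟩, hpq⟩ :=
        hUA p.2 ⟨p, hp, rfl⟩ (lt_of_le_of_ne h (hbne p hp).symm)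
      exact hqa.le.trans ((hS q hq p hp).2 hpq)
  refine ⟨b, ?_⟩
  rintro p (rfl | hp) q (rfl | hq)
  · simp
  · exact h2 q hq
  · exact h1 p hp
  · exact hS p hp q hq

theorem IsPartialIso.exists_extension (hα : HasOnePointExtensions α)
    (hβ : HasOnePointExtensions β) {S : Finset (α × β)}
    (hS : IsPartialIso (S : Set (α × β))) (a : α) (b : β) :
    ∃ T : Finset (α × β), IsPartialIso (T : Set (α × β)) ∧ S ⊆ T ∧
      (∃ y, (a, y) ∈ T) ∧ ∃ x, (x, b) ∈ T := by
  classical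
  obtain ⟨y, hy⟩ := hS.exists_insert hβ a
  have hT : IsPartialIso (((insert (a, y) S).image Prod.swap : Finset (β × α)) : Set (β × α)) := by
    simpa only [Finset.coe_image, Finset.coe_insert] using hy.swap
  obtain ⟨x, hx⟩ := hT.exists_insert hα b
  refine ⟨insert (x, b) (insert (a, y) S), ?_, ?_, ⟨y, by simp⟩, ⟨x, by simp⟩⟩
  · have := hx.swap
    rw [Finset.coe_image, Set.image_insert_eq, Set.image_image] at this
    simpa using this
  · exact fun p hp => by simp [hp]

/-- A partial isomorphism that is total in both directions is an isomorphism. -/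
theorem IsPartialIso.exists_orderIso {T : Set (α × β)} (hT : IsPartialIso T)
    (h₁ : ∀ a, ∃ b, (a, b) ∈ T) (h₂ : ∀ b, ∃ a, (a, b) ∈ T) :
    ∃ e : α ≃o β, ∀ p ∈ T, e p.1 = p.2 := by
  choose f hf using h₁
  choose g hg using h₂
  have key : ∀ p ∈ T, ∀ q ∈ T, p.1 = q.1 ↔ p.2 = q.2 := fun p hp q hq => by
    rw [le_antisymm_iff, le_antisymm_iff, hT p hp q hq, hT q hq p hp]
  refine ⟨⟨⟨f, g, fun a => ?_, fun b => ?_⟩, fun {a a'} => ?_⟩, fun p hp => ?_⟩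
  · exact (key _ (hg (f a)) _ (hf a)).2 rfl
  · exact (key _ (hf (g b)) _ (hg b)).1 rfl
  · exact (hT _ (hf a) _ (hf a')).symm
  · exact (key _ (hf p.1) _ hp).1 rfl

/-- The union of a sequence of partial isomorphisms, the `n`-th of which has the `n`-th point in its
domain and in its range, is an isomorphism. -/
theorem exists_orderIso_of_sequence {S : ℕ → Finset (α × β)} (hmono : ∀ n, S n ⊆ S (n + 1))
    (hS : ∀ n, IsPartialIso (S n : Set (α × β))) (h₁ : ∀ a, ∃ n b, (a, b) ∈ S n)
    (h₂ : ∀ b, ∃ n a, (a, b) ∈ S n) :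
    ∃ e : α ≃o β, ∀ n, ∀ p ∈ S n, e p.1 = p.2 := by
  have hm : Monotone S := monotone_nat_of_le_succ hmono
  have hT : IsPartialIso (⋃ n, (S n : Set (α × β))) := by
    intro p hp q hq
    obtain ⟨m, hm'⟩ := Set.mem_iUnion.1 hp
    obtain ⟨n, hn'⟩ := Set.mem_iUnion.1 hq
    exact hS (max m n) p (hm (le_max_left m n) hm') q (hm (le_max_right m n) hn')
  obtain ⟨e, he⟩ := hT.exists_orderIso
    (fun a => (h₁ a).elim fun n h => h.elim fun b hb => ⟨b, Set.mem_iUnion.2 ⟨n, hb⟩⟩)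
    (fun b => (h₂ b).elim fun n h => h.elim fun a ha => ⟨a, Set.mem_iUnion.2 ⟨n, ha⟩⟩)
  exact ⟨e, fun n p hp => he p (Set.mem_iUnion.2 ⟨n, hp⟩)⟩

theorem HasOnePointExtensions.nonempty (hα : HasOnePointExtensions α) : Nonempty α :=
  (hα ∅ ∅ ∅ (by simp)).elim fun x _ => ⟨x⟩

/-- Back-and-forth, starting from the empty partial isomorphism. -/
theorem HasOnePointExtensions.nonempty_orderIso [Countable α] [Countable β]
    (hα : HasOnePointExtensions α) (hβ : HasOnePointExtensions β) : Nonempty (α ≃o β) := by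
  have := hα.nonempty
  have := hβ.nonempty
  obtain ⟨e, he⟩ := exists_surjective_nat α
  obtain ⟨f, hf⟩ := exists_surjective_nat β
  choose ext hext using fun (S : {S : Finset (α × β) // IsPartialIso (S : Set (α × β))}) (n : ℕ) =>
    S.2.exists_extension hα hβ (e n) (f n)
  let S : ℕ → {S : Finset (α × β) // IsPartialIso (S : Set (α × β))} := fun n =>
    Nat.rec ⟨∅, by simp [IsPartialIso]⟩ (fun n T => ⟨ext T n, (hext T n).1⟩) n
  obtain ⟨i, -⟩ := exists_orderIso_of_sequence (S := fun n => (S n).1)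
    (fun n => (hext (S n) n).2.1) (fun n => (S n).2)
    (fun a => by
      obtain ⟨n, rfl⟩ := he a
      exact ⟨n + 1, (hext (S n) n).2.2.1⟩)
    (fun b => by
      obtain ⟨n, rfl⟩ := hf b
      exact ⟨n + 1, (hext (S n) n).2.2.2⟩)
  exact ⟨i⟩

end PartialIso

/-! ### The extension property of the random poset -/

section RandomPoset

/-- The elements of the finite set `S` together with a new point. -/
inductive AddPoint {α : Type u} (S : Finset α) : Type u
  | old : S → AddPoint S
  | new : AddPoint S

instance {α : Type u} (S : Finset α) : Finite (AddPoint S) := by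
  refine Finite.of_surjective (fun o : Option S => o.elim AddPoint.new AddPoint.old) ?_
  rintro (a | _)
  · exact ⟨some a, rfl⟩
  · exact ⟨none, rfl⟩

/-- The order on `S` together with a new point put above `L` and below `U`. -/
theorem exists_onePoint_order {α : Type u} [PartialOrder α] (S L U : Finset α)
    (hLU : ∀ l ∈ L, ∀ u ∈ U, l < u) :
    ∃ _ : PartialOrder (AddPoint S), (∀ a b : S, (a : α) ≤ b ↔ AddPoint.old a ≤ AddPoint.old b) ∧
      (∀ a : S, AddPoint.old a ≤ AddPoint.new ↔ ∃ l ∈ L, (a : α) ≤ l) ∧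
      (∀ a : S, AddPoint.new ≤ AddPoint.old a ↔ ∃ u ∈ U, u ≤ (a : α)) := by
  let le : AddPoint S → AddPoint S → Prop := fun x y =>
    match x, y with
    | .old a, .old b => (a : α) ≤ b
    | .old a, .new => ∃ l ∈ L, (a : α) ≤ l
    | .new, .old b => ∃ u ∈ U, u ≤ (b : α)
    | .new, .new => True
  let po : PartialOrder (AddPoint S) :=
    { le := le
      le_refl := by rintro (a | _) <;> simp [le]
      le_trans := by
        rintro (a | _) (b | _) (c | _) <;> simp only [le, true_implies, implies_true]
        · exact le_trans
        · rintro hab ⟨l, hl, hbl⟩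
          exact ⟨l, hl, hab.trans hbl⟩
        · rintro ⟨l, hl, hal⟩ ⟨u, hu, huc⟩
          exact hal.trans ((hLU l hl u hu).le.trans huc)
        · exact fun h => h
        · rintro ⟨u, hu, hub⟩ hbc
          exact ⟨u, hu, hub.trans hbc⟩
        · exact fun h => h
      le_antisymm := by
        rintro (a | _) (b | _) <;> simp only [le]
        · exact fun h h' => congrArg AddPoint.old (Subtype.ext (le_antisymm h h'))
        · rintro ⟨l, hl, hbl⟩ ⟨u, hu, hub⟩
          exact absurd (hub.trans hbl) (hLU l hl u hu).not_ge
        · rintro ⟨u, hu, hub⟩ ⟨l, hl, hbl⟩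
          exact absurd (hub.trans hbl) (hLU l hl u hu).not_ge
        · exact fun _ _ => trivial }
  exact ⟨po, fun _ _ => Iff.rfl, fun _ => Iff.rfl, fun _ => Iff.rfl⟩

/-- The finite set with the required point added is a finite poset, so it embeds in `P` because it
belongs to the age; ultrahomogeneity corrects the embedding so that it fixes the finite set. -/
theorem IsRandomPoset.hasOnePointExtensions {P : Type u} [PartialOrder P] [Countable P]
    (hP : IsRandomPoset P) : HasOnePointExtensions P := by
  classical
  intro L U A hLU
  let S := A ∪ (L ∪ U)
  have hLS : L ⊆ S := fun x hx => by simp [S, hx]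
  have hUS : U ⊆ S := fun x hx => by simp [S, hx]
  have hAS : A ⊆ S := fun x hx => by simp [S, hx]
  obtain ⟨po, h1, h2, h3⟩ := exists_onePoint_order S L U hLU
  let _ : FirstOrder.Language.order.Structure P := FirstOrder.Language.orderStructure P
  have : FirstOrder.Language.order.OrderedStructure P := ⟨fun _ => Iff.rfl⟩
  let _ : FirstOrder.Language.order.Structure (AddPoint S) :=
    FirstOrder.Language.orderStructure (AddPoint S)
  have : FirstOrder.Language.order.OrderedStructure (AddPoint S) := ⟨fun _ => Iff.rfl⟩
  let _ : FirstOrder.Language.order.Structure S := FirstOrder.Language.orderStructure S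
  have : FirstOrder.Language.order.OrderedStructure S := ⟨fun _ => Iff.rfl⟩
  have hlim : FirstOrder.Language.IsFraisseLimit finitePosets.{u} P := hP
  have hmem : (⟨AddPoint S, inferInstance⟩ :
      CategoryTheory.Bundled.{u} FirstOrder.Language.order.Structure) ∈ finitePosets.{u} :=
    ⟨inferInstanceAs (Finite (AddPoint S)), FirstOrder.Language.model_partialOrder (M := AddPoint S)⟩
  rw [← hlim.age] at hmem
  have : Nonempty (FirstOrder.Language.order.Embedding (AddPoint S) P) := hmem.2
  let i : S ↪o P := OrderEmbedding.subtype _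
  let j : S ↪o AddPoint S := ⟨⟨AddPoint.old, fun _ _ => AddPoint.old.inj⟩, fun {a b} => (h1 a b).symm⟩
  have hfg : FirstOrder.Language.Structure.FG FirstOrder.Language.order S :=
    FirstOrder.Language.Structure.FG.of_finite
  obtain ⟨f, hf⟩ := hlim.ultrahomogeneous.extend_embedding hfg
    (FirstOrder.Language.StrongHomClass.toEmbedding i)
    (FirstOrder.Language.StrongHomClass.toEmbedding j)
  have hfa : ∀ a : S, f (AddPoint.old a) = a.1 := fun a => (DFunLike.congr_fun hf a).symm
  have hle : ∀ x y, f x ≤ f y ↔ x ≤ y := fun x y => by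
    have := f.map_rel' FirstOrder.Language.leSymb ![x, y]
    rw [FirstOrder.Language.relMap_leSymb, FirstOrder.Language.relMap_leSymb] at this
    exact this
  have hn1 : ∀ a (ha : a ∈ S), a ≤ f AddPoint.new ↔ ∃ l ∈ L, a ≤ l := fun a ha => by
    rw [← h2 ⟨a, ha⟩, ← hle, hfa]
  have hn2 : ∀ a (ha : a ∈ S), f AddPoint.new ≤ a ↔ ∃ u ∈ U, u ≤ a := fun a ha => by
    rw [← h3 ⟨a, ha⟩, ← hle, hfa]
  -- A point of `S` equal to the new one would satisfy `u ≤ a ≤ l` for some `l ∈ L`, `u ∈ U`.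
  have hne : ∀ a ∈ S, a ≠ f AddPoint.new := by
    intro a ha h
    obtain ⟨l, hl, hal⟩ := (hn1 a ha).1 h.le
    obtain ⟨u, hu, hua⟩ := (hn2 a ha).1 h.ge
    exact absurd (hua.trans hal) (hLU l hl u hu).not_ge
  refine ⟨f AddPoint.new, fun h => hne _ (hAS h) rfl, fun l hl => ?_, fun u hu => ?_,
    fun a ha h => (hn1 a (hAS ha)).1 h.le, fun a ha h => (hn2 a (hAS ha)).1 h.le⟩
  · exact lt_of_le_of_ne ((hn1 l (hLS hl)).2 ⟨l, hl, le_rfl⟩) (hne l (hLS hl))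
  · exact lt_of_le_of_ne ((hn2 u (hUS hu)).2 ⟨u, hu, le_rfl⟩) (hne u (hUS hu)).symm

end RandomPoset

/-! ### A generic invariant order and the translation -/

section InvariantOrder

variable {Γ : Type*} [Group Γ]

/-- A `Γ`-invariant strict order on the orbits `Γ × {0}, …, Γ × {n}` for which `Γ × {0}`, ordered
through `φ : Γ → ℤ`, is coinitial and cofinal. -/
structure IsStage (φ : Γ →* Multiplicative ℤ) (n : ℕ) (r : Γ × ℕ → Γ × ℕ → Prop) : Prop where
  irrefl : ∀ x, ¬ r x x
  trans : ∀ x y z, r x y → r y z → r x z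
  supp : ∀ x y, r x y → x.2 ≤ n ∧ y.2 ≤ n
  inv : ∀ γ x y, r x y → r (γ * x.1, x.2) (γ * y.1, y.2)
  base : ∀ β β', r (β, 0) (β', 0) ↔ (φ β).toAdd < (φ β').toAdd
  below : ∀ x : Γ × ℕ, x.2 ≤ n → ∃ β, r (β, 0) x
  above : ∀ x : Γ × ℕ, x.2 ≤ n → ∃ β, r x (β, 0)

theorem isStage_zero (φ : Γ →* Multiplicative ℤ) {a : Γ} (ha : φ a = Multiplicative.ofAdd 1) :
    IsStage φ 0 fun x y => x.2 = 0 ∧ y.2 = 0 ∧ (φ x.1).toAdd < (φ y.1).toAdd where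
  irrefl := by simp
  trans := fun x y z h h' => ⟨h.1, h'.2.1, h.2.2.trans h'.2.2⟩
  supp := fun x y h => ⟨h.1.le, h.2.1.le⟩
  inv := fun γ x y h => ⟨h.1, h.2.1, by simpa using h.2.2⟩
  base := by simp
  below := fun x hx => ⟨x.1 * a⁻¹, rfl, Nat.le_zero.1 hx, by simp [ha]⟩
  above := fun x hx => ⟨x.1 * a, Nat.le_zero.1 hx, rfl, by simp [ha]⟩

/-- A new orbit can be added, with a prescribed type for one of its points. -/
theorem IsStage.exists_succ {φ : Γ →* Multiplicative ℤ} {n : ℕ} {r : Γ × ℕ → Γ × ℕ → Prop}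
    (hr : IsStage φ n r) (L U : Finset (Γ × ℕ)) (hLne : L.Nonempty) (hUne : U.Nonempty)
    (hLU : ∀ l ∈ L, ∀ u ∈ U, r l u) :
    ∃ r', IsStage φ (n + 1) r' ∧ (∀ x y, x.2 ≤ n → y.2 ≤ n → (r' x y ↔ r x y)) ∧
      (∀ x, x.2 ≤ n → (r' x (1, n + 1) ↔ ∃ l ∈ L, x = l ∨ r x l)) ∧
      (∀ x, x.2 ≤ n → (r' (1, n + 1) x ↔ ∃ u ∈ U, u = x ∨ r u x)) := by
  classical
  let c : Γ × ℕ → Γ × ℕ → Prop := fun x y => x = y ∨ r x y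
  have c_trans : ∀ {x y z}, c x y → c y z → c x z := by
    rintro x y z (rfl | h) (rfl | h')
    · exact Or.inl rfl
    · exact Or.inr h'
    · exact Or.inr h
    · exact Or.inr (hr.trans _ _ _ h h')
  have rc_trans : ∀ {x y z}, r x y → c y z → r x z := by
    rintro x y z h (rfl | h')
    exacts [h, hr.trans _ _ _ h h']
  have cr_trans : ∀ {x y z}, c x y → r y z → r x z := by
    rintro x y z (rfl | h) h'
    exacts [h', hr.trans _ _ _ h h']
  let tr : Γ → Γ × ℕ → Γ × ℕ := fun γ x => (γ * x.1, x.2)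
  have tr_mul : ∀ γ δ x, tr γ (tr δ x) = tr (γ * δ) x := fun γ δ x => by simp [tr, mul_assoc]
  have tr_one : ∀ x, tr 1 x = x := fun x => by simp [tr]
  have c_tr : ∀ γ {x y}, c x y → c (tr γ x) (tr γ y) := by
    rintro γ x y (rfl | h)
    exacts [Or.inl rfl, Or.inr (hr.inv _ _ _ h)]
  -- Old points approximating `v`: an old point approximates itself, while the new point `(γ, n +
  -- 1)` is approximated from below by `γ L` (`K = L`) and from above by `γ U` (`K = U`).
  let ap : Finset (Γ × ℕ) → Γ × ℕ → Γ × ℕ → Prop := fun K v d =>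
    (v.2 ≤ n ∧ d = v) ∨ (v.2 = n + 1 ∧ ∃ k ∈ K, d = tr v.1 k)
  have ap_old : ∀ K {v d}, v.2 ≤ n → (ap K v d ↔ d = v) := by
    intro K v d hv
    have : v.2 ≠ n + 1 := by omega
    simp [ap, hv, this]
  have ap_new : ∀ K {v d}, v.2 = n + 1 → (ap K v d ↔ ∃ k ∈ K, d = tr v.1 k) := by
    intro K v d hv
    simp [ap, hv]
  have ap_tr : ∀ γ K {v d}, ap K v d → ap K (tr γ v) (tr γ d) := by
    rintro γ K v d (⟨h, rfl⟩ | ⟨h, k, hk, rfl⟩)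
    · exact Or.inl ⟨h, rfl⟩
    · exact Or.inr ⟨h, k, hk, tr_mul _ _ _⟩
  have new_lt : ∀ {v d e}, v.2 = n + 1 → ap L v d → ap U v e → r d e := by
    intro v d e hv hd he
    obtain ⟨l, hl, rfl⟩ := (ap_new L hv).1 hd
    obtain ⟨u, hu, rfl⟩ := (ap_new U hv).1 he
    exact hr.inv _ _ _ (hLU l hl u hu)
  have ap_le : ∀ {v d e}, v.2 ≤ n + 1 → ap L v d → ap U v e → c d e := by
    intro v d e hv hd he
    rcases Nat.lt_or_ge n v.2 with h | h
    · exact Or.inr (new_lt (by omega) hd he)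
    · rw [ap_old _ h] at hd he
      exact Or.inl (hd.trans he.symm)
  let w : Γ × ℕ → Γ × ℕ → Prop := fun x y => ∃ e d, ap U x e ∧ ap L y d ∧ c e d
  -- `w` puts an upper approximant of `x` weakly below a lower approximant of `y`. This is strict
  -- once a new point is involved; for two old points it also allows equality, so `r x y` is
  -- demanded separately.
  let r' : Γ × ℕ → Γ × ℕ → Prop := fun x y =>
    x.2 ≤ n + 1 ∧ y.2 ≤ n + 1 ∧ (x.2 ≤ n → y.2 ≤ n → r x y) ∧ w x y
  have old : ∀ x y, x.2 ≤ n → y.2 ≤ n → (r' x y ↔ r x y) := by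
    intro x y hx hy
    refine ⟨fun h => h.2.2.1 hx hy, fun h => ⟨by omega, by omega, fun _ _ => h, x, y, ?_, ?_,
      Or.inr h⟩⟩
    · rw [ap_old _ hx]
    · rw [ap_old _ hy]
  have lnew : ∀ x y, x.2 ≤ n → y.2 = n + 1 → (r' x y ↔ ∃ l ∈ L, c x (tr y.1 l)) := by
    intro x y hx hy
    constructor
    · rintro ⟨-, -, -, e, d, he, hd, hc⟩
      rw [ap_old _ hx] at he
      rw [ap_new _ hy] at hd
      obtain ⟨l, hl, rfl⟩ := hd
      exact ⟨l, hl, he ▸ hc⟩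
    · rintro ⟨l, hl, hc⟩
      exact ⟨by omega, by omega, fun _ h => by omega, x, _, (ap_old _ hx).2 rfl,
        (ap_new _ hy).2 ⟨l, hl, rfl⟩, hc⟩
  have unew : ∀ x y, x.2 = n + 1 → y.2 ≤ n → (r' x y ↔ ∃ u ∈ U, c (tr x.1 u) y) := by
    intro x y hx hy
    constructor
    · rintro ⟨-, -, -, e, d, he, hd, hc⟩
      rw [ap_old _ hy] at hd
      rw [ap_new _ hx] at he
      obtain ⟨u, hu, rfl⟩ := he
      exact ⟨u, hu, hd ▸ hc⟩
    · rintro ⟨l, hl, hc⟩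
      exact ⟨by omega, by omega, fun h => by omega, _, y, (ap_new _ hx).2 ⟨l, hl, rfl⟩,
        (ap_old _ hy).2 rfl, hc⟩
  refine ⟨r', ⟨?_, ?_, ?_, ?_, ?_, ?_, ?_⟩, old, fun x hx => ?_, fun x hx => ?_⟩
  · rintro x ⟨hx, -, h, e, d, he, hd, hc⟩
    rcases Nat.lt_or_ge n x.2 with hn | hn
    · exact hr.irrefl _ (cr_trans hc (new_lt (by omega) hd he))
    · exact hr.irrefl _ (h hn hn)
  · rintro x y z ⟨hx, hy, hxy, e, d, he, hd, hc⟩ ⟨-, hz, hyz, e', d', he', hd', hc'⟩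
    refine ⟨hx, hz, fun hxn hzn => ?_, e, d', he, hd', c_trans hc (c_trans (ap_le hy hd he') hc')⟩
    rcases Nat.lt_or_ge n y.2 with hn | hn
    · rw [ap_old _ hxn] at he
      rw [ap_old _ hzn] at hd'
      subst he hd'
      exact rc_trans (cr_trans hc (new_lt (by omega) hd he')) hc'
    · exact hr.trans _ _ _ (hxy hxn hn) (hyz hn hzn)
  · exact fun x y h => ⟨h.1, h.2.1⟩
  · rintro γ x y ⟨hx, hy, hxy, e, d, he, hd, hc⟩
    exact ⟨hx, hy, fun h h' => hr.inv _ _ _ (hxy h h'), _, _, ap_tr γ U he, ap_tr γ L hd,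
      c_tr γ hc⟩
  · intro β β'
    rw [old _ _ (Nat.zero_le n) (Nat.zero_le n), hr.base]
  · intro x hx
    rcases Nat.lt_or_ge n x.2 with hn | hn
    -- A base point below a translate of `l` is below the new point; `u` serves only to show that
    -- `l` is an old point.
    · obtain ⟨l, hl⟩ := hLne
      obtain ⟨u, hu⟩ := hUne
      obtain ⟨β, hβ⟩ := hr.below (tr x.1 l) (hr.supp _ _ (hLU l hl u hu)).1
      exact ⟨β, (lnew _ _ (Nat.zero_le n) (by omega)).2 ⟨l, hl, Or.inr hβ⟩⟩
    · obtain ⟨β, hβ⟩ := hr.below x hn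
      exact ⟨β, (old _ _ (Nat.zero_le n) hn).2 hβ⟩
  · intro x hx
    rcases Nat.lt_or_ge n x.2 with hn | hn
    · obtain ⟨l, hl⟩ := hLne
      obtain ⟨u, hu⟩ := hUne
      obtain ⟨β, hβ⟩ := hr.above (tr x.1 u) (hr.supp _ _ (hLU l hl u hu)).2
      exact ⟨β, (unew _ _ (by omega) (Nat.zero_le n)).2 ⟨u, hu, Or.inr hβ⟩⟩
    · obtain ⟨β, hβ⟩ := hr.above x hn
      exact ⟨β, (old _ _ hn (Nat.zero_le n)).2 hβ⟩
  · rw [lnew _ _ hx rfl]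
    simp only [tr_one, c]
  · rw [unew _ _ rfl hx]
    simp only [tr_one, c]

/-- Bookkeeping: every task recurs at arbitrarily late stages, hence also after all the points it
mentions have appeared. -/
theorem exists_frequently_eq (T : Type*) [Countable T] [Nonempty T] :
    ∃ f : ℕ → T, ∀ t N, ∃ n, N ≤ n ∧ f n = t := by
  obtain ⟨e, he⟩ := exists_surjective_nat T
  refine ⟨fun n => e n.unpair.1, fun t N => ?_⟩
  obtain ⟨m, rfl⟩ := he t
  exact ⟨Nat.pair m N, Nat.right_le_pair m N, by simp⟩

/-- The union of a chain of stages, each adding one free orbit that solves the current task. -/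
theorem exists_invariant_order [Countable Γ] (φ : Γ →* Multiplicative ℤ) {a : Γ}
    (ha : φ a = Multiplicative.ofAdd 1) :
    ∃ r : Γ × ℕ → Γ × ℕ → Prop, (∀ x, ¬ r x x) ∧ (∀ x y z, r x y → r y z → r x z) ∧
      (∀ γ x y, r x y → r (γ * x.1, x.2) (γ * y.1, y.2)) ∧
      (∀ β β', r (β, 0) (β', 0) ↔ (φ β).toAdd < (φ β').toAdd) ∧
      (∀ x, ∃ β, r (β, 0) x) ∧ (∀ x, ∃ β, r x (β, 0)) ∧
      ∀ L U A : Finset (Γ × ℕ), L.Nonempty → U.Nonempty → (∀ l ∈ L, ∀ u ∈ U, r l u) →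
        ∃ x, x ∉ A ∧ (∀ y ∈ A, (r y x ↔ ∃ l ∈ L, y = l ∨ r y l) ∧
          (r x y ↔ ∃ u ∈ U, u = y ∨ r u y)) ∧ (∀ l ∈ L, r l x) ∧ ∀ u ∈ U, r x u := by
  classical
  obtain ⟨task, htask⟩ := exists_frequently_eq (Finset (Γ × ℕ) × Finset (Γ × ℕ))
  have step : ∀ n, ∀ r : {r // IsStage φ n r}, ∃ r' : {r' // IsStage φ (n + 1) r'},
      (∀ x y, x.2 ≤ n → y.2 ≤ n → (r'.1 x y ↔ r.1 x y)) ∧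
      ((task n).1.Nonempty → (task n).2.Nonempty →
        (∀ l ∈ (task n).1, ∀ u ∈ (task n).2, r.1 l u) → ∀ x, x.2 ≤ n →
          (r'.1 x (1, n + 1) ↔ ∃ l ∈ (task n).1, x = l ∨ r.1 x l) ∧
          (r'.1 (1, n + 1) x ↔ ∃ u ∈ (task n).2, u = x ∨ r.1 u x)) := by
    rintro n ⟨r, hr⟩
    by_cases h : (task n).1.Nonempty ∧ (task n).2.Nonempty ∧
        ∀ l ∈ (task n).1, ∀ u ∈ (task n).2, r l u
    · obtain ⟨r', h1, h2, h3, h4⟩ := hr.exists_succ _ _ h.1 h.2.1 h.2.2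
      exact ⟨⟨r', h1⟩, h2, fun _ _ _ x hx => ⟨h3 x hx, h4 x hx⟩⟩
    -- An ill-posed task is replaced by a dummy one, between the base points of degrees zero and
    -- one.
    · obtain ⟨r', h1, h2, -, -⟩ := hr.exists_succ {(1, 0)} {(a, 0)} (by simp) (by simp) (by
        simp [hr.base, ha])
      exact ⟨⟨r', h1⟩, h2, fun i j k => absurd ⟨i, j, k⟩ h⟩
  choose next hnext1 hnext2 using step
  let R : ∀ n, {r // IsStage φ n r} := fun n => Nat.rec ⟨_, isStage_zero φ ha⟩ next n
  have hR1 : ∀ n x y, x.2 ≤ n → y.2 ≤ n → ((R (n + 1)).1 x y ↔ (R n).1 x y) :=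
    fun n => hnext1 n (R n)
  have hR2 := fun n => hnext2 n (R n)
  have hstab : ∀ m n x y, m ≤ n → x.2 ≤ m → y.2 ≤ m → ((R n).1 x y ↔ (R m).1 x y) := by
    intro m n x y hmn hx hy
    induction n, hmn using Nat.le_induction with
    | base => rfl
    | succ n hmn ih => rw [hR1 n x y (hx.trans hmn) (hy.trans hmn), ih]
  let r : Γ × ℕ → Γ × ℕ → Prop := fun x y => (R (max x.2 y.2)).1 x y
  have hr : ∀ n x y, x.2 ≤ n → y.2 ≤ n → (r x y ↔ (R n).1 x y) := fun n x y hx hy =>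
    (hstab _ n x y (max_le hx hy) (le_max_left _ _) (le_max_right _ _)).symm
  refine ⟨r, fun x => (R _).2.irrefl x, fun x y z hxy hyz => ?_, fun γ x y h => (R _).2.inv γ x y h,
    (R 0).2.base, fun x => ?_, fun x => ?_, fun L U A hL hU hLU => ?_⟩
  · have hx : x.2 ≤ max x.2 (max y.2 z.2) := by simp
    have hy : y.2 ≤ max x.2 (max y.2 z.2) := by simp
    have hz : z.2 ≤ max x.2 (max y.2 z.2) := by simp
    rw [hr _ _ _ hx hy] at hxy
    rw [hr _ _ _ hy hz] at hyz
    rw [hr _ _ _ hx hz]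
    exact (R _).2.trans _ _ _ hxy hyz
  · obtain ⟨β, hβ⟩ := (R x.2).2.below x le_rfl
    exact ⟨β, (hr x.2 _ _ (Nat.zero_le _) le_rfl).2 hβ⟩
  · obtain ⟨β, hβ⟩ := (R x.2).2.above x le_rfl
    exact ⟨β, (hr x.2 _ _ le_rfl (Nat.zero_le _)).2 hβ⟩
  · obtain ⟨n, hn, hTn⟩ := htask (L, U) ((A ∪ (L ∪ U)).sup Prod.snd)
    have hle : ∀ y ∈ A ∪ (L ∪ U), y.2 ≤ n := fun y hy => (Finset.le_sup hy).trans hn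
    have hA : ∀ y ∈ A, y.2 ≤ n := fun y hy => hle y (by simp [hy])
    have hL' : ∀ y ∈ L, y.2 ≤ n := fun y hy => hle y (by simp [hy])
    have hU' : ∀ y ∈ U, y.2 ≤ n := fun y hy => hle y (by simp [hy])
    have key := hR2 n
    rw [hTn] at key
    have key := key hL hU fun l hl u hu => (hr n _ _ (hL' l hl) (hU' u hu)).1 (hLU l hl u hu)
    have key' : ∀ y : Γ × ℕ, y.2 ≤ n → (r y (1, n + 1) ↔ ∃ l ∈ L, y = l ∨ r y l) ∧
        (r (1, n + 1) y ↔ ∃ u ∈ U, u = y ∨ r u y) := by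
      intro y hy
      rw [hr (n + 1) y (1, n + 1) (by omega) le_rfl, hr (n + 1) (1, n + 1) y le_rfl (by omega),
        (key y hy).1, (key y hy).2]
      constructor
      · exact exists_congr fun l => and_congr_right fun hl => by rw [hr n _ _ hy (hL' l hl)]
      · exact exists_congr fun u => and_congr_right fun hu => by rw [hr n _ _ (hU' u hu) hy]
    refine ⟨(1, n + 1), fun h => ?_, fun y hy => key' y (hA y hy),
      fun l hl => (key' l (hL' l hl)).1.2 ⟨l, hl, Or.inl rfl⟩,
      fun u hu => (key' u (hU' u hu)).2.2 ⟨u, hu, Or.inl rfl⟩⟩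
    have := hA _ h
    simp at this

/-- A countable group with a homomorphism to `ℤ` acts faithfully on a poset with the one-point
extension property so that the elements of degree one are unbounded translations. -/
theorem exists_poset_action [Countable Γ] (φ : Γ →* Multiplicative ℤ) {a : Γ}
    (ha : φ a = Multiplicative.ofAdd 1) :
    ∃ _ : PartialOrder (Γ × ℕ), HasOnePointExtensions (Γ × ℕ) ∧
      ∃ ρ : Γ →* ((Γ × ℕ) ≃o (Γ × ℕ)), Function.Injective ρ ∧
        ∀ x y, ∀ᶠ k : ℕ in Filter.atTop, x < (ρ a ^ k) y := by
  classical
  obtain ⟨r, irr, tr, inv, base, below, above, ext⟩ := exists_invariant_order φ ha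
  let po : PartialOrder (Γ × ℕ) :=
    { le := fun x y => x = y ∨ r x y
      lt := r
      le_refl := fun x => Or.inl rfl
      le_trans := by
        rintro x y z (rfl | h) (rfl | h')
        exacts [Or.inl rfl, Or.inr h', Or.inr h, Or.inr (tr _ _ _ h h')]
      le_antisymm := by
        rintro x y (rfl | h) (h' | h')
        exacts [rfl, rfl, h'.symm, absurd (tr _ _ _ h h') (irr x)]
      lt_iff_le_not_ge := fun x y => by
        constructor
        · refine fun h => ⟨Or.inr h, ?_⟩
          rintro (rfl | h')
          exacts [irr _ h, irr _ (tr _ _ _ h h')]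
        · rintro ⟨rfl | h, h'⟩
          exacts [absurd (Or.inl rfl) h', h] }
  have base_lt : ∀ β β' : Γ, ((β, 0) : Γ × ℕ) < (β', 0) ↔ (φ β).toAdd < (φ β').toAdd := base
  have hbelow : ∀ x : Γ × ℕ, ∃ N : ℤ, ∀ β, (φ β).toAdd ≤ N → ((β, 0) : Γ × ℕ) < x := by
    intro x
    obtain ⟨β, hβ⟩ := below x
    refine ⟨(φ β).toAdd - 1, fun β' h => lt_trans ((base_lt β' β).2 (by omega)) hβ⟩
  have habove : ∀ x : Γ × ℕ, ∃ N : ℤ, ∀ β, N ≤ (φ β).toAdd → x < ((β, 0) : Γ × ℕ) := by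
    intro x
    obtain ⟨β, hβ⟩ := above x
    refine ⟨(φ β).toAdd + 1, fun β' h => lt_trans hβ ((base_lt β β').2 (by omega))⟩
  choose lo hlo using hbelow
  choose hi hhi using habove
  have degree : ∀ k : ℤ, (φ (a ^ k)).toAdd = k := fun k => by simp [ha]
  refine ⟨po, fun L U A hLU => ?_, ?_⟩
  -- `L` and `U` may be empty here. They are padded by base points below and above all the given
  -- points, which imposes no new relation on `A`.
  · obtain ⟨m, hm⟩ := ((A ∪ (L ∪ U)).image lo).bddBelow
    obtain ⟨M, hM⟩ := ((A ∪ (L ∪ U)).image hi).bddAbove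
    have hlow : ∀ y ∈ A ∪ (L ∪ U), ((a ^ m, 0) : Γ × ℕ) < y := fun y hy =>
      hlo y _ (by rw [degree]; exact hm (by exact_mod_cast Finset.mem_image_of_mem lo hy))
    -- The maximum with `m + 1` keeps the two padding points in order even when all three sets are
    -- empty.
    have hhigh : ∀ y ∈ A ∪ (L ∪ U), y < ((a ^ (max M (m + 1)), 0) : Γ × ℕ) := fun y hy =>
      hhi y _ (by
        rw [degree]
        exact le_max_of_le_left (hM (by exact_mod_cast Finset.mem_image_of_mem hi hy)))
    obtain ⟨x, hxA, hx, hLx, hxU⟩ := ext (insert (a ^ m, 0) L) (insert (a ^ (max M (m + 1)), 0) U)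
      A (by simp) (by simp) (by
        simp only [Finset.mem_insert]
        rintro l (rfl | hl) u (rfl | hu)
        · refine (base_lt _ _).2 ?_
          rw [degree, degree]
          exact lt_of_lt_of_le (lt_add_one m) (le_max_right _ _)
        · exact hlow u (by simp [hu])
        · exact hhigh l (by simp [hl])
        · exact hLU l hl u hu)
    refine ⟨x, hxA, fun l hl => hLx l (by simp [hl]), fun u hu => hxU u (by simp [hu]),
      fun y hy hyx => ?_, fun y hy hxy => ?_⟩
    · obtain ⟨l, hl, hyl⟩ := (hx y hy).1.1 hyx
      rcases Finset.mem_insert.1 hl with rfl | hl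
      · have hyl : y ≤ (a ^ m, 0) := hyl
        exact absurd hyl (hlow y (by simp [hy])).not_ge
      · exact ⟨l, hl, hyl⟩
    · obtain ⟨u, hu, hyu⟩ := (hx y hy).2.1 hxy
      rcases Finset.mem_insert.1 hu with rfl | hu
      · have hyu : (a ^ (max M (m + 1)), 0) ≤ y := hyu
        exact absurd hyu (hhigh y (by simp [hy])).not_ge
      · exact ⟨u, hu, hyu⟩
  · let act : Γ → (Γ × ℕ) → (Γ × ℕ) := fun γ x => (γ * x.1, x.2)
    have hact : ∀ γ x y, x ≤ y → act γ x ≤ act γ y := by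
      rintro γ x y (rfl | h)
      exacts [Or.inl rfl, Or.inr (inv γ _ _ h)]
    have hinv : ∀ γ x, act γ⁻¹ (act γ x) = x := fun γ x => by simp [act]
    have hinv' : ∀ γ x, act γ (act γ⁻¹ x) = x := fun γ x => by simp [act]
    let ρ : Γ →* ((Γ × ℕ) ≃o (Γ × ℕ)) :=
      { toFun := fun γ => ⟨⟨act γ, act γ⁻¹, hinv γ, hinv' γ⟩, fun {x y} =>
          ⟨fun h => by
            have := hact γ⁻¹ (act γ x) (act γ y) h
            rwa [hinv, hinv] at this, hact γ x y⟩⟩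
        map_one' := by
          exact DFunLike.ext _ _ fun x => Prod.ext (one_mul _) rfl
        map_mul' := fun γ δ => by
          exact DFunLike.ext _ _ fun x => Prod.ext (mul_assoc _ _ _) rfl }
    have hρ : ∀ γ x, ρ γ x = (γ * x.1, x.2) := fun _ _ => rfl
    refine ⟨ρ, fun γ δ h => ?_, fun x y => ?_⟩
    · simpa [hρ] using DFunLike.congr_fun h (1, 0)
    -- The base point `a ^ (hi x - k)` then lies below `y`, and its translate by `a ^ k` is `a ^ hi
    -- x`, which lies above `x`.
    · filter_upwards [Filter.eventually_ge_atTop (hi x - lo y).toNat] with k hk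
      rw [← map_pow]
      have h1 : x < ((a ^ (hi x), 0) : Γ × ℕ) := hhi x _ (degree _).ge
      have h2 : ((a ^ (lo y), 0) : Γ × ℕ) < y := hlo y _ (degree _).le
      have h3 : ((a ^ (hi x), 0) : Γ × ℕ) ≤ ρ (a ^ k) (a ^ (hi x - k), 0) := by
        rw [hρ]
        refine le_of_eq (Prod.ext ?_ rfl)
        change a ^ hi x = a ^ k * a ^ (hi x - k)
        rw [← zpow_natCast, ← zpow_add]
        congr 1
        ring
      have h4 : ((a ^ (hi x - k), 0) : Γ × ℕ) < y := hlo y _ (by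
        rw [degree]
        omega)
      exact h1.trans_le (h3.trans ((ρ (a ^ k)).lt_iff_lt.2 h4).le)

/-- On the random poset, some automorphism translates every point above every other one, and it is a
member of a free pair. -/
theorem HasOnePointExtensions.exists_translation {P : Type*} [PartialOrder P] [Countable P]
    (hP : HasOnePointExtensions P) :
    ∃ g u : P ≃o P, (∀ x y, ∀ᶠ k : ℕ in Filter.atTop, x < (g ^ k) y) ∧ GenerateFreeGroup g u := by
  -- Only the degree of the first generator matters; the second is given degree zero.
  let φ : FreeGroup (Fin 2) →* Multiplicative ℤ := FreeGroup.lift ![Multiplicative.ofAdd 1, 1]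
  obtain ⟨po, hQ, ρ, hρ, htr⟩ := exists_poset_action φ (a := FreeGroup.of 0) (by simp [φ])
  obtain ⟨e⟩ := hQ.nonempty_orderIso hP
  let c : ((FreeGroup (Fin 2) × ℕ) ≃o (FreeGroup (Fin 2) × ℕ)) →* (P ≃o P) :=
    { toFun := fun f => (e.symm.trans f).trans e
      map_one' := by ext x; simp
      map_mul' := fun f f' => by ext x; simp }
  have hc : ∀ f x, c f x = e (f (e.symm x)) := fun _ _ => rfl
  refine ⟨c (ρ (.of 0)), c (ρ (.of 1)), fun x y => ?_, ?_⟩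
  · filter_upwards [htr (e.symm x) (e.symm y)] with k hk
    rw [← map_pow, hc]
    exact (e.symm_apply_lt).1 hk
  · have : (FreeGroup.lift ![c (ρ (.of 0)), c (ρ (.of 1))] : FreeGroup (Fin 2) →* (P ≃o P))
        = c.comp ρ := by
      ext i : 1
      fin_cases i <;> simp
    rw [GenerateFreeGroup, this]
    refine Function.Injective.comp (g := c) (fun f f' h => ?_) hρ
    refine DFunLike.ext _ _ fun x => ?_
    have := DFunLike.congr_fun h (e x)
    simpa [hc] using this

end InvariantOrder

/-! ### Encoding a sequence in one automorphism -/

section Generic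

variable {P : Type*} [PartialOrder P]

theorem tendsto_orderAut {ι : Type*} {l : Filter ι} {f : ι → (P ≃o P)} {c : P ≃o P}
    (h : ∀ x, ∀ᶠ i in l, f i x = c x) : Filter.Tendsto f l (𝓝 c) := by
  let _ : TopologicalSpace P := ⊥
  have : DiscreteTopology P := ⟨rfl⟩
  have hi : IsInducing (fun (g : P ≃o P) (x : P) => g x) := ⟨rfl⟩
  rw [hi.tendsto_nhds_iff, tendsto_pi_nhds]
  intro x
  rw [nhds_discrete, Filter.tendsto_pure]
  exact h x

theorem eventually_orderAut_eq (c : P ≃o P) (x : P) : ∀ᶠ u in 𝓝 c, u x = c x :=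
  (isOpen_orderAut_eval x (c x)).mem_nhds rfl

/-- Every sequence of automorphisms is encoded, on blocks translated by powers of `g`, in a single
automorphism depending continuously on the sequence. -/
theorem HasOnePointExtensions.exists_continuous_encoding [Countable P]
    (hP : HasOnePointExtensions P) {g : P ≃o P}
    (hg : ∀ x y, ∀ᶠ k : ℕ in Filter.atTop, x < (g ^ k) y) {B : ℕ → Finset P} :
    ∃ (H : (ℕ → (P ≃o P)) → (P ≃o P)) (k : ℕ → ℕ), Continuous H ∧
      ∀ s j, ∀ x ∈ B j, s j x ∈ B j → H s ((g ^ k j) x) = (g ^ k j) (s j x) := by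
  classical
  have := hP.nonempty
  obtain ⟨e, he⟩ := exists_surjective_nat P
  -- The extension is a total function of `S`, with a junk value off partial isomorphisms, so that
  -- equal data give equal extensions; continuity of `H` depends on this.
  have hext : ∀ (S : Finset (P × P)) (n : ℕ), ∃ T : Finset (P × P),
      IsPartialIso (S : Set (P × P)) → IsPartialIso (T : Set (P × P)) ∧ S ⊆ T ∧
        (∃ y, (e n, y) ∈ T) ∧ ∃ x, (x, e n) ∈ T := by
    intro S n
    by_cases hS : IsPartialIso (S : Set (P × P))
    · obtain ⟨T, hT⟩ := hS.exists_extension hP hP (e n) (e n)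
      exact ⟨T, fun _ => hT⟩
    · exact ⟨∅, fun h => absurd h hS⟩
  choose ext hext using hext
  have hk : ∀ (W : Finset (Finset (P × P))) (n : ℕ), ∃ k : ℕ, ∀ S ∈ W, ∀ p ∈ S, ∀ b ∈ B n,
      p.1 < (g ^ k) b ∧ p.2 < (g ^ k) b := by
    intro W n
    refine Filter.Eventually.exists (f := Filter.atTop) ?_
    simp only [Filter.eventually_all_finset]
    exact fun S _ p _ b _ => (hg p.1 b).and (hg p.2 b)
  choose k hk using hk
  let sh : ℕ → P × P → P × P := fun k p => ((g ^ k) p.1, (g ^ k) p.2)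
  let Φ : ℕ → ℕ → Finset (P × P) → Finset (P × P) → Finset (P × P) := fun k n S T =>
    ext (S ∪ T.image (sh k)) n
  -- A finite set containing every approximation possible at stage `n`, whatever the sequence; a
  -- shift clearing all of them is independent of the sequence.
  let W : ℕ → Finset (Finset (P × P)) := fun n => Nat.rec {∅} (fun n W =>
    (W ×ˢ (B n ×ˢ B n).powerset).image fun q => Φ (k W n) n q.1 q.2) n
  let F : ℕ → (P ≃o P) → Finset (P × P) := fun n u =>
    (B n ×ˢ B n).filter fun p => u p.1 = p.2
  let q : (ℕ → (P ≃o P)) → ℕ → Finset (P × P) := fun s n =>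
    Nat.rec ∅ (fun n S => Φ (k (W n) n) n S (F n (s n))) n
  have hqW : ∀ s n, q s n ∈ W n := by
    intro s n
    induction n with
    | zero => exact Finset.mem_singleton_self _
    | succ n ih =>
      exact Finset.mem_image.2 ⟨(q s n, F n (s n)),
        Finset.mem_product.2 ⟨ih, Finset.mem_powerset.2 (Finset.filter_subset _ _)⟩, rfl⟩
  have hstep : ∀ (s : ℕ → (P ≃o P)) (n : ℕ), IsPartialIso (SetLike.coe (q s n)) →
      IsPartialIso ((q s n ∪ (F n (s n)).image (sh (k (W n) n)) : Finset (P × P)) :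
        Set (P × P)) := by
    intro s n hq
    have hF : ∀ p ∈ F n (s n), p.1 ∈ B n ∧ p.2 ∈ B n ∧ s n p.1 = p.2 := fun p hp => by
      simpa [F, and_assoc] using hp
    have hlt := hk (W n) n (q s n) (hqW s n)
    intro p hp p' hp'
    rw [Finset.mem_coe, Finset.mem_union, Finset.mem_image] at hp hp'
    rcases hp with hp | ⟨p, hp, rfl⟩ <;> rcases hp' with hp' | ⟨p', hp', rfl⟩
    · exact hq p hp p' hp'
    -- The shifted block lies above all older points in both coordinates, so the mixed comparisons
    -- agree automatically.
    · exact iff_of_true (hlt p hp _ (hF p' hp').1).1.le (hlt p hp _ (hF p' hp').2.1).2.le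
    · exact iff_of_false (hlt p' hp' _ (hF p hp).1).1.not_ge (hlt p' hp' _ (hF p hp).2.1).2.not_ge
    · simp only [sh, OrderIso.le_iff_le]
      rw [← (hF p hp).2.2, ← (hF p' hp').2.2, OrderIso.le_iff_le]
  have hq : ∀ (s : ℕ → (P ≃o P)) (n : ℕ), IsPartialIso (SetLike.coe (q s n)) := by
    intro s n
    induction n with
    | zero => simp [q, IsPartialIso]
    | succ n ih => exact (hext _ n (hstep s n ih)).1
  have hqs : ∀ s n, q s n ∪ (F n (s n)).image (sh (k (W n) n)) ⊆ q s (n + 1) ∧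
      (∃ y, (e n, y) ∈ q s (n + 1)) ∧ ∃ x, (x, e n) ∈ q s (n + 1) := fun s n =>
    (hext _ n (hstep s n (hq s n))).2
  have hH : ∀ s, ∃ h : P ≃o P, ∀ n, ∀ p ∈ q s n, h p.1 = p.2 := fun s =>
    exists_orderIso_of_sequence (S := q s) (fun n => Finset.union_subset_left (hqs s n).1) (hq s)
      (fun a => by
        obtain ⟨n, rfl⟩ := he a
        exact ⟨n + 1, (hqs s n).2.1⟩)
      (fun a => by
        obtain ⟨n, rfl⟩ := he a
        exact ⟨n + 1, (hqs s n).2.2⟩)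
  choose H hH using hH
  have hFc : ∀ n (u : P ≃o P), ∀ᶠ v in 𝓝 u, F n v = F n u := by
    intro n u
    have : ∀ᶠ v in 𝓝 u, ∀ x ∈ B n, v x = u x := by
      rw [Filter.eventually_all_finset]
      exact fun x _ => eventually_orderAut_eq u x
    filter_upwards [this] with v hv
    refine Finset.filter_congr fun p hp => ?_
    rw [hv p.1 (Finset.mem_product.1 hp).1]
  -- Stage `n` sees only the first `n` terms of the sequence, each on a finite block.
  have hqc : ∀ n s, ∀ᶠ t in 𝓝 s, q t n = q s n := by
    intro n s
    induction n with
    | zero => exact Filter.Eventually.of_forall fun _ => rfl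
    | succ n ih =>
      filter_upwards [ih, (continuous_apply n).continuousAt.eventually (hFc n (s n))] with t h1 h2
      change Φ _ n (q t n) (F n (t n)) = Φ _ n (q s n) (F n (s n))
      rw [h1, h2]
  refine ⟨H, fun n => k (W n) n, continuous_iff_continuousAt.2 fun s => tendsto_orderAut fun x => ?_,
    fun s j x hx hsx => ?_⟩
  · obtain ⟨n, rfl⟩ := he x
    obtain ⟨y, hy⟩ := (hqs s n).2.1
    filter_upwards [hqc (n + 1) s] with t ht
    exact (hH t (n + 1) (e n, y) (ht ▸ hy)).trans (hH s (n + 1) (e n, y) hy).symm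
  · refine hH s (j + 1) (sh (k (W j) j) (x, s j x)) ((hqs s j).1 (Finset.mem_union_right _ ?_))
    exact Finset.mem_image_of_mem _ (by simp [F, hx, hsx])

/-- All terms of a sequence of automorphisms are limits of conjugates by powers of `g` of a single
automorphism depending continuously on the sequence; the powers do not depend on the sequence. -/
theorem HasOnePointExtensions.exists_tendsto_conj [Countable P]
    (hP : HasOnePointExtensions P) {g : P ≃o P}
    (hg : ∀ x y, ∀ᶠ k : ℕ in Filter.atTop, x < (g ^ k) y) :
    ∃ (H : (ℕ → (P ≃o P)) → (P ≃o P)) (k : ℕ → ℕ → ℤ), Continuous H ∧ ∀ d m,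
      Filter.Tendsto (fun i => g ^ k m i * H d * g ^ (-k m i)) Filter.atTop (𝓝 (d m)) := by
  classical
  have := hP.nonempty
  obtain ⟨e, he⟩ := exists_surjective_nat P
  obtain ⟨H, k, hH, hk⟩ := hP.exists_continuous_encoding hg
    (B := fun n => (Finset.range n).image e)
  -- Each term `d m` is encoded at all stages `Nat.pair m i`, on blocks that exhaust `P` as `i`
  -- grows.
  refine ⟨fun d => H fun j => d j.unpair.1, fun m i => -(k (Nat.pair m i) : ℤ),
    hH.comp (continuous_pi fun j => continuous_apply _), fun d m => tendsto_orderAut fun x => ?_⟩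
  obtain ⟨a, ha⟩ := he x
  obtain ⟨b, hb⟩ := he (d m x)
  filter_upwards [Filter.eventually_gt_atTop a, Filter.eventually_gt_atTop b] with i hai hbi
  have hi : i ≤ Nat.pair m i := Nat.right_le_pair m i
  have := hk (fun j => d j.unpair.1) (Nat.pair m i) x
    (Finset.mem_image.2 ⟨a, Finset.mem_range.2 (hai.trans_le hi), ha⟩)
    (Finset.mem_image.2 ⟨b, Finset.mem_range.2 (hbi.trans_le hi), by simpa using hb⟩)
  rw [neg_neg, zpow_neg, zpow_natCast, RelIso.mul_apply, RelIso.mul_apply, this]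
  simp

end Generic

/-! ### Relations pass to limits of conjugates -/

section FreePair

variable {G : Type*} [Group G] [TopologicalSpace G] [IsTopologicalGroup G]

theorem continuous_freeGroup_lift (g : G) (w : FreeGroup (Fin 2)) :
    Continuous fun u : G => FreeGroup.lift ![g, u] w := by
  induction w using FreeGroup.induction_on with
  | C1 => simpa using continuous_const
  | of i =>
    fin_cases i
    · simpa using continuous_const
    · simpa using continuous_id'
  | inv_of i h => exact (h.inv).congr fun u => (map_inv _ _).symm
  | mul x y hx hy => exact (hx.mul hy).congr fun u => (map_mul _ _ _).symm

/-- Conjugation by `g ^ l` is an automorphism fixing `g`. -/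
theorem freeGroup_lift_conj {G : Type*} [Group G] (g h : G) (l : ℤ) (w : FreeGroup (Fin 2)) :
    FreeGroup.lift ![g, g ^ l * h * g ^ (-l)] w
      = g ^ l * FreeGroup.lift ![g, h] w * g ^ (-l) := by
  have : FreeGroup.lift ![g, g ^ l * h * g ^ (-l)]
      = (MulAut.conj (g ^ l)).toMonoidHom.comp (FreeGroup.lift ![g, h]) := by
    ext i : 1
    fin_cases i
    · simp [-map_zpow, MulAut.conj_apply, (Commute.zpow_self g l).eq]
    · simp [-map_zpow, MulAut.conj_apply]
  rw [this]
  simp [-map_zpow, MulAut.conj_apply]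

/-- A relation between `g` and `h` holds between `g` and every limit of conjugates of `h` by
powers of `g`. -/
theorem freeGroup_lift_eq_one_of_tendsto [T2Space G] {g h u : G} {k : ℕ → ℤ}
    (hu : Filter.Tendsto (fun i => g ^ k i * h * g ^ (-k i)) Filter.atTop (𝓝 u))
    {w : FreeGroup (Fin 2)} (hw : FreeGroup.lift ![g, h] w = 1) :
    FreeGroup.lift ![g, u] w = 1 := by
  refine tendsto_nhds_unique (((continuous_freeGroup_lift g w).tendsto u).comp hu) ?_
  refine tendsto_const_nhds.congr fun i => ?_
  rw [Function.comp_apply, freeGroup_lift_conj, hw]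
  simp

end FreePair

/-! ### Separability for convergence in measure -/

section MeasurableFunctions

variable {X : Type*} [MeasurableSpace X] {μ : Measure X}

/-- The function taking the value `y p.2` on the set `A p.1`, where `p` is the first member of the
list for which the point lies in that set. -/
noncomputable def listPiecewise {Y : Type*} (A : ℕ → Set X) (y : ℕ → Y) : List (ℕ × ℕ) → X → Y
  | [], _ => y 0
  | p :: c, x => open Classical in if x ∈ A p.1 then y p.2 else listPiecewise A y c x

theorem stronglyMeasurable_listPiecewise {Y : Type*} [TopologicalSpace Y] {A : ℕ → Set X}
    (hA : ∀ n, MeasurableSet (A n)) (y : ℕ → Y) (c : List (ℕ × ℕ)) :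
    StronglyMeasurable (listPiecewise A y c) := by
  classical
  induction c with
  | nil => exact stronglyMeasurable_const
  | cons p c ih => exact StronglyMeasurable.ite (hA p.1) stronglyMeasurable_const ih

-- Induction on `N`: an approximation of the level set of `N` is put at the head of the list. New
-- errors occur only on its symmetric difference with that level set.
open scoped symmDiff in
theorem exists_listPiecewise_approx {Y : Type*} {A : ℕ → Set X}
    (hA : μ.MeasureDense (Set.range A)) [IsFiniteMeasure μ] (y : ℕ → Y) {φ : X → ℕ}
    (hφ : Measurable φ) (N : ℕ) (ε : ℝ) (hε : 0 < ε) :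
    ∃ c, μ {x | φ x < N ∧ listPiecewise A y c x ≠ y (φ x)} < ENNReal.ofReal ε := by
  classical
  induction N generalizing ε with
  | zero => exact ⟨[], by simpa using hε⟩
  | succ N ih =>
    obtain ⟨c, hc⟩ := ih (ε / 2) (by positivity)
    obtain ⟨_, ⟨a, rfl⟩, ha⟩ := hA.approx (φ ⁻¹' {N}) (hφ (measurableSet_singleton N))
      (measure_ne_top μ _) (ε / 2) (by positivity)
    refine ⟨(a, N) :: c, ?_⟩
    have hsub : {x | φ x < N + 1 ∧ listPiecewise A y ((a, N) :: c) x ≠ y (φ x)} ⊆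
        {x | φ x < N ∧ listPiecewise A y c x ≠ y (φ x)} ∪ (φ ⁻¹' {N}) ∆ (A a) := by
      rintro x ⟨hx, hne⟩
      by_contra hcon
      simp only [Set.mem_union, Set.mem_ofPred_eq, Set.mem_symmDiff, Set.mem_preimage,
        Set.mem_singleton_iff] at hcon
      apply hne
      by_cases hxN : φ x = N
      · have hxa : x ∈ A a := by tauto
        simp [listPiecewise, hxa, hxN]
      · have hxa : x ∉ A a := by tauto
        have hlt : φ x < N := by omega
        have : listPiecewise A y c x = y (φ x) := by tauto
        simp [listPiecewise, hxa, this]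
    calc _ ≤ _ := measure_mono hsub
      _ ≤ _ := measure_union_le _ _
      _ < ENNReal.ofReal (ε / 2) + ENNReal.ofReal (ε / 2) := ENNReal.add_lt_add hc ha
      _ = ENNReal.ofReal ε := by
        rw [← ENNReal.ofReal_add (by positivity) (by positivity), add_halves]

/-- Measurable functions into a separable metric space are separable for convergence in measure. -/
theorem exists_dense_sequence_inMeasure [IsSeparable μ] [IsProbabilityMeasure μ] {Y : Type*}
    [MetricSpace Y] [TopologicalSpace.SeparableSpace Y] [Nonempty Y] :
    ∃ D : ℕ → X → Y, (∀ m, StronglyMeasurable (D m)) ∧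
      ∀ f : X → Y, StronglyMeasurable f → ∀ δ > 0, ∀ ε > 0,
        ∃ m, 1 - ε < μ.real {x | dist (D m x) (f x) < δ} := by
  classical
  obtain ⟨𝒜, h𝒜c, h𝒜⟩ := MeasureTheory.exists_countable_measureDense (μ := μ)
  obtain ⟨A, rfl⟩ := h𝒜c.exists_eq_range h𝒜.nonempty
  obtain ⟨e, he⟩ := exists_surjective_nat (List (ℕ × ℕ))
  let y : ℕ → Y := TopologicalSpace.denseSeq Y
  refine ⟨fun m => listPiecewise A y (e m),
    fun m => stronglyMeasurable_listPiecewise (fun n => h𝒜.measurable _ ⟨n, rfl⟩) y _,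
    fun f hf δ hδ ε hε => ?_⟩
  have hex : ∀ x, ∃ n, dist (y n) (f x) < δ := fun x => by
    obtain ⟨_, ⟨n, rfl⟩, hn⟩ := Metric.mem_closure_iff.1
      ((TopologicalSpace.denseRange_denseSeq Y) (f x)) δ hδ
    exact ⟨n, by rwa [dist_comm]⟩
  -- `y ∘ φ` is a countably valued approximation of `f`. Cutting off the values of index at least
  -- `N` costs `ε / 2`, and approximating the remaining finitely many level sets costs another `ε /
  -- 2`.
  let φ : X → ℕ := fun x => Nat.find (hex x)
  have hφd : ∀ x, dist (y (φ x)) (f x) < δ := fun x => Nat.find_spec (hex x)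
  have hφ : Measurable φ := measurable_find hex fun n =>
    measurableSet_lt (stronglyMeasurable_const.dist hf).measurable measurable_const
  have hlim : Filter.Tendsto (fun N => μ {x | N ≤ φ x}) Filter.atTop (𝓝 0) := by
    have := tendsto_measure_iInter_atTop (μ := μ) (s := fun N : ℕ => {x | N ≤ φ x})
      (fun N => (hφ measurableSet_Ici).nullMeasurableSet)
      (fun M N hMN x (hx : N ≤ φ x) => le_trans hMN hx) ⟨0, measure_ne_top μ _⟩
    have hempty : ⋂ N : ℕ, {x | N ≤ φ x} = ∅ := by
      ext x
      simp only [Set.mem_iInter, Set.mem_ofPred_eq, Set.mem_empty_iff_false, iff_false, not_forall]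
      exact ⟨φ x + 1, by omega⟩
    rwa [hempty, measure_empty] at this
  obtain ⟨N, hN⟩ := (hlim.eventually (gt_mem_nhds
    (ENNReal.ofReal_pos.2 (half_pos hε)))).exists
  obtain ⟨c, hc⟩ := exists_listPiecewise_approx h𝒜 y hφ N (ε / 2) (half_pos hε)
  obtain ⟨m, rfl⟩ := he c
  refine ⟨m, ?_⟩
  have hsub : {x | dist (listPiecewise A y (e m) x) (f x) < δ}ᶜ ⊆
      {x | N ≤ φ x} ∪ {x | φ x < N ∧ listPiecewise A y (e m) x ≠ y (φ x)} := by
    intro x hx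
    rcases le_or_gt N (φ x) with h | h
    · exact Or.inl h
    · exact Or.inr ⟨h, fun heq => hx (by
        change dist (listPiecewise A y (e m) x) (f x) < δ
        rw [heq]
        exact hφd x)⟩
  have hlt : μ {x | dist (listPiecewise A y (e m) x) (f x) < δ}ᶜ < ENNReal.ofReal ε := by
    calc _ ≤ _ := measure_mono hsub
      _ ≤ _ := measure_union_le _ _
      _ < ENNReal.ofReal (ε / 2) + ENNReal.ofReal (ε / 2) := ENNReal.add_lt_add hN hc
      _ = ENNReal.ofReal ε := by
        rw [← ENNReal.ofReal_add (by positivity) (by positivity), add_halves]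
  have hmeas : MeasurableSet {x | dist (listPiecewise A y (e m) x) (f x) < δ} :=
    measurableSet_lt ((stronglyMeasurable_listPiecewise (fun n => h𝒜.measurable _ ⟨n, rfl⟩) y
      _).dist hf).measurable measurable_const
  have hreal : μ.real {x | dist (listPiecewise A y (e m) x) (f x) < δ}ᶜ < ε :=
    (ENNReal.lt_ofReal_iff_toReal_lt (measure_ne_top μ _)).1 hlt
  rw [probReal_compl_eq_one_sub hmeas] at hreal
  linarith

end MeasurableFunctions

/-! ### Calculus of classes of functions -/

section LZero

variable {X : Type*} [MeasurableSpace X] {μ : Measure X}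

/-- The class of a function. -/
noncomputable def LZero.mk {Y : Type*} [TopologicalSpace Y] (f : X → Y)
    (hf : AEStronglyMeasurable f μ) : LZero μ Y :=
  AEEqFun.mk f hf

theorem LZero.rep_mk {Y : Type*} [TopologicalSpace Y] (f : X → Y)
    (hf : AEStronglyMeasurable f μ) : (LZero.mk f hf).rep =ᵐ[μ] f :=
  AEEqFun.coeFn_mk f hf

theorem LZero.stronglyMeasurable_rep {Y : Type*} [TopologicalSpace Y] (f : LZero μ Y) :
    StronglyMeasurable f.rep :=
  AEEqFun.stronglyMeasurable (μ := μ) f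

theorem LZero.mk_eq_mk {Y : Type*} [TopologicalSpace Y] {f f' : X → Y}
    {hf : AEStronglyMeasurable f μ} {hf' : AEStronglyMeasurable f' μ} :
    LZero.mk f hf = LZero.mk f' hf' ↔ f =ᵐ[μ] f' :=
  AEEqFun.mk_eq_mk

variable {G : Type*} [Group G] [TopologicalSpace G] [IsTopologicalGroup G]

theorem LZero.mk_mul_mk {f f' : X → G} (hf : AEStronglyMeasurable f μ)
    (hf' : AEStronglyMeasurable f' μ) :
    LZero.mk f hf * LZero.mk f' hf' = LZero.mk (f * f') (hf.mul hf') :=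
  AEEqFun.mk_mul_mk f f' hf hf'

theorem LZero.mk_inv {f : X → G} (hf : AEStronglyMeasurable f μ) :
    (LZero.mk f hf)⁻¹ = LZero.mk f⁻¹ hf.inv :=
  AEEqFun.inv_mk f hf

theorem LZero.one_eq_mk : (1 : LZero μ G) = LZero.mk 1 aestronglyMeasurable_one :=
  rfl

theorem LZero.mk_zpow {f : X → G} (hf : AEStronglyMeasurable f μ) (l : ℤ) :
    (LZero.mk f hf) ^ l = LZero.mk (f ^ l) ((continuous_zpow l).comp_aestronglyMeasurable hf) :=
  AEEqFun.mk_zpow f hf l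

/-- Words are evaluated pointwise, so a relation between classes becomes a relation at almost every
point. -/
theorem LZero.lift_mk {f f' : X → G} (hf : AEStronglyMeasurable f μ)
    (hf' : AEStronglyMeasurable f' μ) (w : FreeGroup (Fin 2)) :
    ∃ hw : AEStronglyMeasurable (fun x => FreeGroup.lift ![f x, f' x] w) μ,
      FreeGroup.lift ![LZero.mk f hf, LZero.mk f' hf'] w = LZero.mk _ hw := by
  induction w using FreeGroup.induction_on with
  | C1 => exact ⟨by simpa using aestronglyMeasurable_const, by simp [LZero.one_eq_mk]; rfl⟩
  | of i =>
    fin_cases i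
    · exact ⟨by simpa using hf, by simp⟩
    · exact ⟨by simpa using hf', by simp⟩
  | inv_of i h =>
    obtain ⟨h1, h2⟩ := h
    have heq : (fun x => FreeGroup.lift ![f x, f' x] (FreeGroup.of i)⁻¹) =
        (fun x => FreeGroup.lift ![f x, f' x] (FreeGroup.of i))⁻¹ :=
      funext fun x => map_inv _ _
    refine ⟨heq ▸ h1.inv, ?_⟩
    rw [map_inv, h2, LZero.mk_inv]
    simp only [heq]
  | mul v w hv hw =>
    obtain ⟨h1, h2⟩ := hv
    obtain ⟨h3, h4⟩ := hw
    have heq : (fun x => FreeGroup.lift ![f x, f' x] (v * w)) =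
        (fun x => FreeGroup.lift ![f x, f' x] v) * fun x => FreeGroup.lift ![f x, f' x] w :=
      funext fun x => map_mul _ _ _
    refine ⟨heq ▸ h1.mul h3, ?_⟩
    rw [map_mul, h2, h4, LZero.mk_mul_mk]
    simp only [heq]

/-- A sequence converging pointwise enters every basic neighbourhood of its limit. -/
theorem LZero.exists_mem_basicNhd {Y : Type*} [tY : TopologicalSpace Y] (d : MetricSpace Y)
    (hd : d.toUniformSpace.toTopologicalSpace = tY) [IsProbabilityMeasure μ]
    {F : ℕ → X → Y} (hF : ∀ i, StronglyMeasurable (F i)) {f : X → Y}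
    (hlim : ∀ x, Filter.Tendsto (fun i => F i x) Filter.atTop (𝓝 (f x)))
    {t : ℝ} {δ : ℝ} {p : LZero μ Y}
    (ht : t < μ.real {x | d.dist (f x) (p.rep x) < δ}) :
    ∃ i, t < μ.real {x | d.dist
      ((LZero.mk (μ := μ) (F i) (hF i).aestronglyMeasurable).rep x) (p.rep x) < δ} := by
  subst hd
  -- These sets increase, and by pointwise convergence they cover the set where the limit is
  -- `δ`-close to `p`; the measure is continuous from below.
  let s : ℕ → Set X := fun n => ⋂ i ≥ n, {x | dist (F i x) (p.rep x) < δ}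
  have hs : Monotone s := fun m n hmn =>
    Set.biInter_mono (fun i hi => le_trans hmn hi) fun _ _ => le_rfl
  have hsub : {x | dist (f x) (p.rep x) < δ} ⊆ ⋃ n, s n := by
    intro x hx
    have := ((hlim x).dist (tendsto_const_nhds (x := p.rep x))).eventually (gt_mem_nhds hx)
    obtain ⟨n, hn⟩ := Filter.eventually_atTop.1 this
    exact Set.mem_iUnion.2 ⟨n, Set.mem_iInter₂.2 hn⟩
  have hT : Filter.Tendsto (fun n => μ.real (s n)) Filter.atTop (𝓝 (μ.real (⋃ n, s n))) :=
    (ENNReal.tendsto_toReal (measure_ne_top μ _)).comp (tendsto_measure_iUnion_atTop hs)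
  obtain ⟨n, hn⟩ := (hT.eventually (lt_mem_nhds (ht.trans_le (measureReal_mono hsub)))).exists
  refine ⟨n, hn.trans_le ?_⟩
  have hrep : μ.real
      {x | dist ((LZero.mk (μ := μ) (F n) (hF n).aestronglyMeasurable).rep x) (p.rep x) < δ}
      = μ.real {x | dist (F n x) (p.rep x) < δ} := by
    refine measureReal_congr ?_
    filter_upwards [LZero.rep_mk (μ := μ) (F n) (hF n).aestronglyMeasurable] with x hx
    change (dist _ _ < δ) = (dist _ _ < δ)
    rw [hx]
  exact (measureReal_mono (Set.biInter_subset_of_mem (le_refl n))).trans_eq hrep.symm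

end LZero

/-! ### The powers of the group and the group of measurable functions -/

section Main

variable {P : Type*} [PartialOrder P] [Countable P]

theorem HasOnePointExtensions.exists_free_cyclicallyGenerates_pi (hP : HasOnePointExtensions P)
    (n : ℕ) (hn : 1 ≤ n) :
    ∃ g h : Fin n → (P ≃o P), CyclicallyGenerates g h ∧ GenerateFreeGroup g h := by
  obtain ⟨g, u, hg, hu⟩ := hP.exists_translation
  obtain ⟨H, k, -, hH⟩ := hP.exists_tendsto_conj hg
  -- Index `0` is reserved for the free partner `u` of `g`; the dense sequence starts at index `1`.
  let D : ℕ → Fin n → (P ≃o P) := fun m =>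
    Nat.casesOn m (fun _ => u) (TopologicalSpace.denseSeq (Fin n → (P ≃o P)))
  let h : Fin n → (P ≃o P) := fun i => H fun m => D m i
  let c : Fin n → (P ≃o P) := fun _ => g
  have hlim : ∀ m, Filter.Tendsto (fun i => c ^ k m i * h * c ^ (-k m i)) Filter.atTop (𝓝 (D m)) :=
    fun m => tendsto_pi_nhds.2 fun j => hH (fun m => D m j) m
  refine ⟨c, h, ?_, ?_⟩
  · refine Dense.of_closure
      ((TopologicalSpace.denseRange_denseSeq (Fin n → (P ≃o P))).mono ?_)
    rintro _ ⟨m, rfl⟩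
    exact mem_closure_of_tendsto (hlim (m + 1))
      (Filter.Eventually.of_forall fun i => ⟨k (m + 1) i, rfl⟩)
  · refine (injective_iff_map_eq_one _).2 fun w hw => ?_
    have hw' := freeGroup_lift_eq_one_of_tendsto (hlim 0) hw
    -- One coordinate suffices for freeness, and `1 ≤ n` provides it.
    have hpi : (Pi.evalMonoidHom (fun _ : Fin n => (P ≃o P)) ⟨0, hn⟩).comp
        (FreeGroup.lift ![c, D 0]) = FreeGroup.lift ![g, u] := by
      ext j : 1
      fin_cases j <;> simp [c, D]
    refine (injective_iff_map_eq_one _).1 hu w ?_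
    rw [← hpi, MonoidHom.comp_apply, hw', map_one]

/-- Points of `X` play the role of coordinates: the encoding is applied at each point with common
exponents, and the conjugates converge everywhere, hence in measure. -/
theorem HasOnePointExtensions.exists_free_cyclicallyGenerates_LZero (hP : HasOnePointExtensions P)
    {X : Type*} [MeasurableSpace X] (μ : Measure X) [IsSeparable μ] [IsProbabilityMeasure μ] :
    ∃ g h : LZero μ (P ≃o P), CyclicallyGenerates g h ∧ GenerateFreeGroup g h := by
  obtain ⟨g, u, hg, hu⟩ := hP.exists_translation
  obtain ⟨H, k, hHc, hH⟩ := hP.exists_tendsto_conj hg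
  let d : MetricSpace (P ≃o P) := compatibleCompleteMetric (P ≃o P)
  have hd : d.toUniformSpace.toTopologicalSpace = orderAutTopology := rfl
  obtain ⟨E, hEm, hE⟩ := exists_dense_sequence_inMeasure (μ := μ) (Y := P ≃o P)
  let D : ℕ → X → (P ≃o P) := fun m => Nat.casesOn m (fun _ => u) E
  have hDm : ∀ m, StronglyMeasurable (D m) := fun m => by
    cases m
    exacts [stronglyMeasurable_const, hEm _]
  let h : X → (P ≃o P) := fun x => H fun m => D m x
  have hh : StronglyMeasurable h := by
    borelize (P ≃o P)
    exact hHc.comp_stronglyMeasurable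
      (measurable_pi_lambda _ fun m => (hDm m).measurable).stronglyMeasurable
  have hg' : AEStronglyMeasurable (fun _ : X => g) μ := aestronglyMeasurable_const
  refine ⟨LZero.mk (fun _ => g) hg', LZero.mk h hh.aestronglyMeasurable, ?_, ?_⟩
  · refine dense_iff_inter_open.2 fun U hU ⟨p, hp⟩ => ?_
    obtain ⟨δ, hδ, ε, hε, hsub⟩ := hU p hp
    obtain ⟨m, hm⟩ := hE p.rep p.stronglyMeasurable_rep δ hδ ε hε
    have hFm : ∀ i, StronglyMeasurable fun x => g ^ k (m + 1) i * h x * g ^ (-k (m + 1) i) :=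
      fun i => (stronglyMeasurable_const.mul hh).mul stronglyMeasurable_const
    obtain ⟨i, hi⟩ := LZero.exists_mem_basicNhd d hd hFm
      (fun x => hH (fun m => D m x) (m + 1)) hm
    refine ⟨_, hsub hi, k (m + 1) i, ?_⟩
    rw [LZero.mk_zpow, LZero.mk_zpow, LZero.mk_mul_mk, LZero.mk_mul_mk]
    rfl
  · refine (injective_iff_map_eq_one _).2 fun w hw => ?_
    obtain ⟨hw', heq⟩ := LZero.lift_mk hg' hh.aestronglyMeasurable w
    rw [heq, LZero.one_eq_mk, LZero.mk_eq_mk] at hw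
    -- A relation holding almost everywhere holds at some point, where it passes to `g` and `u`.
    obtain ⟨x, hx⟩ := hw.exists
    exact (injective_iff_map_eq_one _).1 hu w
      (freeGroup_lift_eq_one_of_tendsto (hH (fun m => D m x) 0) hx)

end Main

theorem mainTheorem7 {P : Type*} [PartialOrder P] [Countable P] (hP : IsRandomPoset P)
    {X : Type*} [MeasurableSpace X] [StandardBorelSpace X]
    (μ : Measure X) [IsProbabilityMeasure μ] [NullSingletonClass μ] :
    (∀ n : ℕ, 1 ≤ n → HasCyclicallyDenseConjClass (Fin n → (P ≃o P))) ∧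
    HasCyclicallyDenseConjClass (LZero μ (P ≃o P)) ∧
    (∀ n : ℕ, 1 ≤ n → ∃ g h : Fin n → (P ≃o P),
      CyclicallyGenerates g h ∧ GenerateFreeGroup g h) ∧
    (∃ g h : LZero μ (P ≃o P), CyclicallyGenerates g h ∧ GenerateFreeGroup g h) := by
  have hE := hP.hasOnePointExtensions
  have h1 := hE.exists_free_cyclicallyGenerates_pi
  have h2 := hE.exists_free_cyclicallyGenerates_LZero μ
  refine ⟨fun n hn => ?_, ?_, h1, h2⟩
  · obtain ⟨g, h, hgh, -⟩ := h1 n hn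
    exact ⟨g, h, hgh⟩
  · obtain ⟨g, h, hgh, -⟩ := h2
    exact ⟨g, h, hgh⟩
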